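/- Let $1\le m\le n$ and $\bar J\in\mathbb{R}^{m\times n}$. A *reduced QR decomposition* of (the transpose of) an $m\times n$ real matrix $J$ is a factorization $J=C\hat J$ where $\hat J\in\mathbb{R}^{m\times n}$ has orthonormal rows ($\hat J\hat J^T=I_m$) and $C=[c_{ij}]\in\mathbb{R}^{m\times m}$ is lower triangular with $c_{aa}\ge 0$ for all $a$, and with $c_{ia}=0$ for all $i$ whenever $c_{aa}=0$. For a nonzero square matrix $M=[m_{ij}]$ let the *diagonalization number* be $$\mathrm{dn}(M)=\frac{\sum_a m_{aa}^2}{\sum_{a,b}m_{ab}^2}.$$ Let $\bar J=\bar C\hat{\bar J}$, $\bar C=[\bar c_{ij}]$, be the reduced QR decomposition of $\bar J$. For every $w\in(0,\infty)$ let $\bar J^T\bar J+w^2I_n=R^TR$ be the Cholesky decomposition, with $R\in\mathbb{R}^{n\times n}$ upper triangular with positive diagonal entries, and let $\bar JR^{-1}=C\hat J$, $C=[c_{ij}]$, be the reduced QR decomposition of $\bar JR^{-1}$ ($R$, $C$ and $\hat J$ depend on $w$). For $1\le a\le m$ let $\bar d_a=(\bar c_{ia})_{a<i\le m}$ be the part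 of the $a$-th column of $\bar C$ below the diagonal, let $\bar C_a=[\bar c_{ij}]_{a<i,j\le m}$ be the trailing square block of $\bar C$, and let $\sigma_{\max}$, $\sigma_{\min}$ denote the largest and the smallest singular value. Put $$\underline\nu_a^2=\frac{w^2\|\bar d_a\|^2}{\sigma_{\max}^2(\bar C_a)+w^2},\qquad \overline\nu_a^2=\frac{w^2\|\bar d_a\|^2}{\sigma_{\min}^2(\bar C_a)+w^2}\quad(a<m),\qquad \underline\nu_m^2=\overline\nu_m^2=0,$$ $$\alpha_a^2=\frac{\bar c_{aa}^2}{\bar c_{aa}^2+w^2+\overline\nu_a^2},\qquad \beta_a^2=\frac{\bar c_{aa}^2}{\bar c_{aa}^2+w^2+\underline\nu_a^2},\qquad \rho^2=\sum_{a=1}^m\frac{\bar\sigma_a^2}{\bar\sigma_a^2+w^2},$$ where $\bar\sigma_1\ge\dots\ge\bar\sigma_m\ge0$ are the singular values of $\bar J$. Then: 0. For every $w>0$ the matrix $\bar C^T\bar C+w^2I_m$ has a factorization $\tilde C^T\tilde C$ with $\tilde C\in\mathbb{R}^{m\times m}$ lower triangular with positive diagonal entries, and for any such $\tilde C$ we have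 $C=\bar C\tilde C^{-1}$. 1. For every $w>0$ and every $a$, $\alpha_a^2\le c_{aa}^2\le\beta_a^2$. If $\bar J\ne0$, then moreover $C\ne0$, $\rho^2>0$ and $$\frac1{\rho^2}\sum_{a=1}^m\alpha_a^2\le\mathrm{dn}(C)\le\frac1{\rho^2}\sum_{a=1}^m\beta_a^2 .$$ 2. As $w\to\infty$, $c_{aa}^2\to0$ for every $a$; and if $\bar J\ne0$, then $\bar C\neq 0$ and $\mathrm{dn}(C)\to\mathrm{dn}(\bar C)$. 3. If $\mathrm{rank}(\bar J)=m$, then $c_{aa}^2\to1$ for every $a$ and $\mathrm{dn}(C)\to1$ as $w\to0^+$. -/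

import Mathlib

open Filter Topology Matrix

noncomputable section

/-- `J = C * Jhat` is the reduced QR decomposition of `Jᵀ`: the rows of `Jhat` are orthonormal,
`C` is lower triangular with nonnegative diagonal entries, and a column of `C` whose diagonal entry
is zero vanishes (so that `C` is determined by `J`, of whatever rank). -/
structure IsReducedQR {m n : ℕ} (J : Matrix (Fin m) (Fin n) ℝ)
    (C : Matrix (Fin m) (Fin m) ℝ) (Jhat : Matrix (Fin m) (Fin n) ℝ) : Prop where
  eq_mul : J = C * Jhat
  orthonormal_rows : Jhat * Jhatᵀ = 1
  lower : ∀ i j, i < j → C i j = 0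
  diag_nonneg : ∀ a, 0 ≤ C a a
  column_zero : ∀ a, C a a = 0 → ∀ i, C i a = 0

/-- `W = Rᵀ * R` with `R` upper triangular with positive diagonal entries. -/
structure IsCholeskyFactor {n : ℕ} (W R : Matrix (Fin n) (Fin n) ℝ) : Prop where
  eq_mul : W = Rᵀ * R
  upper : ∀ i j, j < i → R i j = 0
  diag_pos : ∀ i, 0 < R i i

/-- `W = Lᵀ * L` with `L` lower triangular with positive diagonal entries. -/
structure IsReverseCholeskyFactor {n : ℕ} (W L : Matrix (Fin n) (Fin n) ℝ) : Prop where
  eq_mul : W = Lᵀ * L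
  lower : ∀ i j, i < j → L i j = 0
  diag_pos : ∀ i, 0 < L i i

/-- The singular values of a real matrix in decreasing order, counted from `0`. -/
def matrixSingularValue {ι κ : Type*} [Fintype ι] [DecidableEq ι] [Fintype κ] [DecidableEq κ]
    (A : Matrix ι κ ℝ) (k : ℕ) : ℝ :=
  (Matrix.toEuclideanLin A).singularValues k

/-- The largest singular value. -/
def sigmaMax {ι : Type*} [Fintype ι] [DecidableEq ι] (A : Matrix ι ι ℝ) : ℝ :=
  matrixSingularValue A 0

/-- The smallest singular value of a square matrix, the last one of as many as there are columns. -/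
def sigmaMin {ι : Type*} [Fintype ι] [DecidableEq ι] (A : Matrix ι ι ℝ) : ℝ :=
  matrixSingularValue A (Fintype.card ι - 1)

/-- The diagonalization number of a nonzero square matrix. -/
def diagNumber {m : ℕ} (M : Matrix (Fin m) (Fin m) ℝ) : ℝ :=
  (∑ a, M a a ^ 2) / ∑ a, ∑ b, M a b ^ 2

/-- The trailing square block of `M` on the rows and columns after the `a`-th. -/
def trailingBlock {m : ℕ} (M : Matrix (Fin m) (Fin m) ℝ) (a : Fin m) :
    Matrix {i : Fin m // a < i} {i : Fin m // a < i} ℝ :=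
  M.submatrix Subtype.val Subtype.val

/-- The squared Euclidean norm of the part of the `a`-th column of `M` below the diagonal. -/
def belowDiagNormSq {m : ℕ} (M : Matrix (Fin m) (Fin m) ℝ) (a : Fin m) : ℝ :=
  ∑ i : {i : Fin m // a < i}, M i a ^ 2

/-- `w² ‖d_a‖² / (σ_max(C_a)² + w²)`; zero for the last index, where `d_a` is empty. -/
def nuLowerSq {m : ℕ} (Cbar : Matrix (Fin m) (Fin m) ℝ) (w : ℝ) (a : Fin m) : ℝ :=
  w ^ 2 * belowDiagNormSq Cbar a / (sigmaMax (trailingBlock Cbar a) ^ 2 + w ^ 2)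

/-- `w² ‖d_a‖² / (σ_min(C_a)² + w²)`; zero for the last index, where `d_a` is empty. -/
def nuUpperSq {m : ℕ} (Cbar : Matrix (Fin m) (Fin m) ℝ) (w : ℝ) (a : Fin m) : ℝ :=
  w ^ 2 * belowDiagNormSq Cbar a / (sigmaMin (trailingBlock Cbar a) ^ 2 + w ^ 2)

/-- The lower bound of the squared diagonal entries. -/
def alphaSq {m : ℕ} (Cbar : Matrix (Fin m) (Fin m) ℝ) (w : ℝ) (a : Fin m) : ℝ :=
  Cbar a a ^ 2 / (Cbar a a ^ 2 + w ^ 2 + nuUpperSq Cbar w a)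

/-- The upper bound of the squared diagonal entries. -/
def betaSq {m : ℕ} (Cbar : Matrix (Fin m) (Fin m) ℝ) (w : ℝ) (a : Fin m) : ℝ :=
  Cbar a a ^ 2 / (Cbar a a ^ 2 + w ^ 2 + nuLowerSq Cbar w a)

/-- The sum of `σ_a² / (σ_a² + w²)` over the first `m` singular values `σ_a` of the `m × n` matrix
`Jbar`, `m ≤ n`. -/
def rhoSq {m n : ℕ} (Jbar : Matrix (Fin m) (Fin n) ℝ) (w : ℝ) : ℝ :=
  ∑ a : Fin m, matrixSingularValue Jbar a ^ 2 / (matrixSingularValue Jbar a ^ 2 + w ^ 2)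

end

/-! Write K for `Cbar`, Q for `Jbarhat`, and let L be a lower triangular factor of KᵀK + w² = LᵀL.
Since the rows of Q are orthonormal, the Gram matrix C Cᵀ = J̄(J̄ᵀJ̄ + w²)⁻¹J̄ᵀ equals K(KᵀK +
w²)⁻¹Kᵀ = (K L⁻¹)(K L⁻¹)ᵀ. A Gram matrix determines its normalized triangular factor
(`eq_of_mul_transpose_eq_of_lower`), so C = K L⁻¹ and the diagonal entries of C are the quotients K
a a / L a a.

The number (L a a)² is the minimum of ‖Lv‖² = ‖Kv‖² + w²‖v‖² over vectors v that vanish before a and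
have entry 1 at a. With d the part of column a of K below the diagonal and A the trailing block,
this is (K a a)² + w² plus the minimum over y of ‖d + Ay‖² + w²‖y‖². The extreme singular values of
A enclose this regularized least squares value between the two ν², which gives α² and β².

The squared Frobenius norm of C is the trace of J̄(J̄ᵀJ̄ + w²)⁻¹J̄ᵀ, that is ρ²; this turns the
entrywise bounds into bounds on the diagonalization number. For large w, both w²(C a a)² and w²ρ²
converge, to (K a a)² and to the squared Frobenius norm of K. For small w and full rank, α² tends to
1 while (C a a)² and ρ²/m stay at most 1. -/

namespace Matrix

/-! ### Lower triangular matrices and uniqueness of the triangular factor -/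

variable {m : ℕ}

theorem mul_apply_self_of_lower {A B : Matrix (Fin m) (Fin m) ℝ}
    (hA : ∀ i j, i < j → A i j = 0) (hB : ∀ i j, i < j → B i j = 0) (a : Fin m) :
    (A * B) a a = A a a * B a a := by
  rw [mul_apply, Finset.sum_eq_single a _ (by simp)]
  intro k _ hk
  rcases lt_or_gt_of_ne hk with h | h
  · rw [hB k a h, mul_zero]
  · rw [hA a k h, zero_mul]

theorem mul_lower {A B : Matrix (Fin m) (Fin m) ℝ}
    (hA : ∀ i j, i < j → A i j = 0) (hB : ∀ i j, i < j → B i j = 0) :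
    ∀ i j, i < j → (A * B) i j = 0 := by
  intro i j hij
  rw [mul_apply]
  refine Finset.sum_eq_zero fun k _ => ?_
  rcases lt_or_ge i k with h | h
  · rw [hA i k h, zero_mul]
  · rw [hB k j (h.trans_lt hij), mul_zero]

theorem isUnit_det_of_lower {L : Matrix (Fin m) (Fin m) ℝ}
    (hL : ∀ i j, i < j → L i j = 0) (hd : ∀ i, L i i ≠ 0) : IsUnit L.det := by
  rw [det_of_isLowerTriangular L (fun i j h => hL i j h)]
  exact (Finset.prod_ne_zero_iff.2 fun i _ => hd i).isUnit

theorem inv_lower {L : Matrix (Fin m) (Fin m) ℝ}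
    (hL : ∀ i j, i < j → L i j = 0) (hd : ∀ i, L i i ≠ 0) :
    ∀ i j, i < j → L⁻¹ i j = 0 := by
  have := L.invertibleOfIsUnitDet (isUnit_det_of_lower hL hd)
  have h : L.IsLowerTriangular := fun i j h => hL i j h
  intro i j hij
  exact blockTriangular_inv_of_blockTriangular h hij

theorem inv_apply_self_of_lower {L : Matrix (Fin m) (Fin m) ℝ}
    (hL : ∀ i j, i < j → L i j = 0) (hd : ∀ i, L i i ≠ 0) (a : Fin m) :
    L⁻¹ a a = (L a a)⁻¹ := by
  have h := mul_apply_self_of_lower hL (inv_lower hL hd) a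
  rw [mul_nonsing_inv _ (isUnit_det_of_lower hL hd), one_apply_eq] at h
  exact eq_inv_of_mul_eq_one_right h.symm

/-- A Gram matrix determines its lower triangular factor, if the diagonal is nonnegative and the
columns with vanishing diagonal entry vanish. -/
theorem eq_of_mul_transpose_eq_of_lower {L D : Matrix (Fin m) (Fin m) ℝ}
    (hL : ∀ i j, i < j → L i j = 0) (hL0 : ∀ a, 0 ≤ L a a) (hLc : ∀ a, L a a = 0 → ∀ i, L i a = 0)
    (hD : ∀ i j, i < j → D i j = 0) (hD0 : ∀ a, 0 ≤ D a a) (hDc : ∀ a, D a a = 0 → ∀ i, D i a = 0)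
    (h : L * Lᵀ = D * Dᵀ) : L = D := by
  -- The terms with k > j vanish, so column j of the Gram matrix involves only columns up to j of
  -- the factor.
  have expand : ∀ {A : Matrix (Fin m) (Fin m) ℝ}, (∀ i j, i < j → A i j = 0) → ∀ i j,
      (A * Aᵀ) i j = A i j * A j j + ∑ k ∈ Finset.univ.filter (· < j), A i k * A j k := by
    intro A hA i j
    rw [mul_apply, Finset.sum_filter, ← Finset.add_sum_erase _ _ (Finset.mem_univ j)]
    congr 1
    rw [← Finset.add_sum_erase (Finset.univ : Finset (Fin m)) (fun k => if k < j then _ else _)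
      (Finset.mem_univ j)]
    simp only [lt_irrefl, if_false, zero_add, transpose_apply]
    refine Finset.sum_congr rfl fun k hk => ?_
    split_ifs with hkj
    · rfl
    · rw [hA j k (lt_of_le_of_ne (not_lt.1 hkj) (Finset.ne_of_mem_erase hk).symm), mul_zero]
  -- Strong induction over columns: the earlier columns cancel, the case i = j fixes the pivot by
  -- its sign, and the rest of the column follows by division, or by the zero-column convention if
  -- the pivot is zero.
  have key : ∀ j : Fin m, ∀ i, L i j = D i j := by
    intro j
    induction j using WellFoundedLT.induction with
    | ind j ih =>
      have e : ∀ i, L i j * L j j = D i j * D j j := by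
        intro i
        have h1 := expand hL i j
        rw [h, expand hD i j] at h1
        have h2 : ∑ k ∈ Finset.univ.filter (· < j), D i k * D j k
            = ∑ k ∈ Finset.univ.filter (· < j), L i k * L j k := by
          refine Finset.sum_congr rfl fun k hk => ?_
          rw [ih k (Finset.mem_filter.1 hk).2, ih k (Finset.mem_filter.1 hk).2]
        linarith
      have ej : L j j = D j j := by
        have := e j
        exact (mul_self_inj (hL0 j) (hD0 j)).1 this
      intro i
      by_cases hz : L j j = 0
      · rw [hLc j hz, hDc j (ej ▸ hz)]
      · have := e i
        rw [← ej] at this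
        exact mul_right_cancel₀ hz this
  ext i j
  exact key j i

end Matrix

/-! ### Existence of the reverse Cholesky factor -/

/-- The LDL decomposition of M⁻¹, rather than of M, yields the reversed order of factors: from P M⁻¹
Pᵀ = D with P lower triangular follows M = Pᵀ D⁻¹ P, and a square root of D⁻¹ is absorbed into P. -/
theorem Matrix.PosDef.exists_isReverseCholeskyFactor {m : ℕ} {M : Matrix (Fin m) (Fin m) ℝ}
    (hM : M.PosDef) : ∃ L, IsReverseCholeskyFactor M L := by
  have hS : M⁻¹.PosDef := hM.inv
  set P := LDL.lowerInv hS with hP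
  have hPlow : ∀ i j, i < j → P i j = 0 := fun i j h => LDL.lowerInv_triangular hS h
  have hPu : IsUnit P.det := P.isUnit_det_of_invertible
  have hPd : ∀ i, P i i ≠ 0 := by
    rw [det_of_isLowerTriangular P (fun i j h => hPlow i j h)] at hPu
    exact fun i => Finset.prod_ne_zero_iff.1 hPu.ne_zero i (Finset.mem_univ i)
  set d := LDL.diagEntries hS with hd
  have hdiag : diagonal d = P * M⁻¹ * Pᵀ := by
    have := LDL.diag_eq_lowerInv_conj hS
    simpa only [LDL.diag, conjTranspose_eq_transpose_of_trivial] using this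
  have hpd : (P * M⁻¹ * Pᵀ).PosDef := by
    have := hS.mul_mul_conjTranspose_same (B := P)
      (vecMul_injective_iff_isUnit.2 ((isUnit_iff_isUnit_det P).2 hPu))
    simpa only [conjTranspose_eq_transpose_of_trivial] using this
  have hdpos : ∀ i, 0 < d i := by
    intro i
    have := hpd.diag_pos (i := i)
    rwa [← hdiag, diagonal_apply_eq] at this
  have hMe : M = Pᵀ * diagonal (fun i => (d i)⁻¹) * P := by
    have hinv : (diagonal d)⁻¹ = diagonal (fun i => (d i)⁻¹) := by
      apply inv_eq_right_inv
      rw [diagonal_mul_diagonal, ← diagonal_one]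
      congr 1
      ext i
      exact mul_inv_cancel₀ (hdpos i).ne'
    have hPtu : IsUnit Pᵀ.det := by rwa [det_transpose]
    rw [← hinv, hdiag, mul_inv_rev, mul_inv_rev, nonsing_inv_nonsing_inv _
      ((isUnit_iff_isUnit_det M).1 hM.isUnit), ← Matrix.mul_assoc, mul_nonsing_inv _ hPtu,
      Matrix.one_mul, Matrix.mul_assoc, nonsing_inv_mul _ hPu, Matrix.mul_one]
  -- The sign makes the diagonal of `diagonal s * P` positive and disappears in the square.
  let s : Fin m → ℝ := fun i => SignType.sign (P i i) / √(d i)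
  have hs : ∀ i, s i * s i = (d i)⁻¹ := by
    intro i
    have h1 : ((SignType.sign (P i i) : ℝ)) * (SignType.sign (P i i) : ℝ) = 1 := by
      rcases lt_or_gt_of_ne (hPd i) with h | h <;> simp [h]
    simp only [s]
    rw [div_mul_div_comm, h1, Real.mul_self_sqrt (hdpos i).le, one_div]
  refine ⟨diagonal s * P, ?_, ?_, ?_⟩
  · rw [transpose_mul, diagonal_transpose, Matrix.mul_assoc, ← Matrix.mul_assoc (diagonal s),
      diagonal_mul_diagonal, ← Matrix.mul_assoc, hMe]
    simp only [hs]
  · intro i j hij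
    rw [diagonal_mul, hPlow i j hij, mul_zero]
  · intro i
    rw [diagonal_mul]
    simp only [s]
    rw [div_mul_eq_mul_div, sign_mul_self]
    exact div_pos (abs_pos.2 (hPd i)) (Real.sqrt_pos.2 (hdpos i))

/-! ### Norm bounds and traces through singular values -/

namespace LinearMap

variable {E F : Type*} [NormedAddCommGroup E] [InnerProductSpace ℝ E] [FiniteDimensional ℝ E]
  [NormedAddCommGroup F] [InnerProductSpace ℝ F] [FiniteDimensional ℝ F]

/-- Expand ⟨x, T*Tx⟩ in an orthonormal eigenbasis of T*T, whose eigenvalues are the squared singular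
values. -/
theorem norm_sq_apply_eq_sum_singularValues (T : E →ₗ[ℝ] F) {n : ℕ}
    (hn : Module.finrank ℝ E = n) (x : E) :
    ‖T x‖ ^ 2 = ∑ i : Fin n, T.singularValues i ^ 2 *
      inner ℝ (T.isSymmetric_adjoint_comp_self.eigenvectorBasis hn i) x ^ 2 := by
  set hT := T.isSymmetric_adjoint_comp_self
  set b := hT.eigenvectorBasis hn
  have h1 : ‖T x‖ ^ 2 = inner ℝ x ((adjoint T ∘ₗ T) x) := by
    rw [comp_apply, adjoint_inner_right, real_inner_self_eq_norm_sq]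
  rw [h1, ← b.sum_inner_mul_inner]
  refine Finset.sum_congr rfl fun i _ => ?_
  rw [← hT, hT.apply_eigenvectorBasis, inner_smul_left, T.sq_singularValues_fin hn,
    real_inner_comm x]
  simp
  ring

theorem norm_sq_apply_le (T : E →ₗ[ℝ] F) (x : E) :
    ‖T x‖ ^ 2 ≤ T.singularValues 0 ^ 2 * ‖x‖ ^ 2 := by
  rw [T.norm_sq_apply_eq_sum_singularValues rfl,
    ← (T.isSymmetric_adjoint_comp_self.eigenvectorBasis rfl).sum_sq_norm_inner_right x,
    Finset.mul_sum]
  refine Finset.sum_le_sum fun i _ => ?_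
  rw [Real.norm_eq_abs, sq_abs]
  have := T.singularValues_antitone (Nat.zero_le i)
  have := T.singularValues_nonneg i
  gcongr

theorem le_norm_sq_apply (T : E →ₗ[ℝ] F) (x : E) :
    T.singularValues (Module.finrank ℝ E - 1) ^ 2 * ‖x‖ ^ 2 ≤ ‖T x‖ ^ 2 := by
  rw [T.norm_sq_apply_eq_sum_singularValues rfl,
    ← (T.isSymmetric_adjoint_comp_self.eigenvectorBasis rfl).sum_sq_norm_inner_right x,
    Finset.mul_sum]
  refine Finset.sum_le_sum fun i _ => ?_
  rw [Real.norm_eq_abs, sq_abs]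
  have := T.singularValues_antitone (show (i : ℕ) ≤ Module.finrank ℝ E - 1 by have := i.2; omega)
  have := T.singularValues_nonneg (Module.finrank ℝ E - 1)
  gcongr

end LinearMap

namespace Matrix

variable {ι : Type*} [Fintype ι]

theorem mulVec_dotProduct_self_eq_norm_sq [DecidableEq ι] {κ : Type*} [Fintype κ]
    (A : Matrix κ ι ℝ) (x : ι → ℝ) :
    (A *ᵥ x) ⬝ᵥ (A *ᵥ x) = ‖toEuclideanLin A (WithLp.toLp 2 x)‖ ^ 2 := by
  rw [EuclideanSpace.real_norm_sq_eq]
  simp [dotProduct, sq]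

theorem dotProduct_self_eq_norm_sq (x : ι → ℝ) :
    x ⬝ᵥ x = ‖(WithLp.toLp 2 x : EuclideanSpace ℝ ι)‖ ^ 2 := by
  rw [EuclideanSpace.real_norm_sq_eq]
  simp [dotProduct, sq]

theorem mulVec_dotProduct_self_le [DecidableEq ι] (A : Matrix ι ι ℝ) (x : ι → ℝ) :
    (A *ᵥ x) ⬝ᵥ (A *ᵥ x) ≤ sigmaMax A ^ 2 * (x ⬝ᵥ x) := by
  rw [mulVec_dotProduct_self_eq_norm_sq, dotProduct_self_eq_norm_sq]
  exact LinearMap.norm_sq_apply_le _ _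

theorem le_mulVec_dotProduct_self [DecidableEq ι] (A : Matrix ι ι ℝ) (x : ι → ℝ) :
    sigmaMin A ^ 2 * (x ⬝ᵥ x) ≤ (A *ᵥ x) ⬝ᵥ (A *ᵥ x) := by
  rw [mulVec_dotProduct_self_eq_norm_sq, dotProduct_self_eq_norm_sq]
  have := LinearMap.le_norm_sq_apply (toEuclideanLin A) (WithLp.toLp 2 x)
  rwa [finrank_euclideanSpace] at this

theorem dotProduct_sq_le (x y : ι → ℝ) : (x ⬝ᵥ y) ^ 2 ≤ (x ⬝ᵥ x) * (y ⬝ᵥ y) := by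
  simpa only [dotProduct, ← sq] using Finset.sum_mul_sq_le_sq_mul_sq Finset.univ x y

theorem zero_le_dotProduct_self (x : ι → ℝ) : 0 ≤ x ⬝ᵥ x :=
  Finset.sum_nonneg fun _ _ => mul_self_nonneg _

/-- If σ = `sigmaMin A` is nonzero, A is invertible and x = Au with σ‖u‖ ≤ ‖x‖; then ‖x‖² = ⟨Aᵀx, u⟩
≤ ‖Aᵀx‖‖u‖ gives the bound for Aᵀ. It is needed because the least squares minimizer involves A Aᵀ.
-/
theorem le_transpose_mulVec_dotProduct_self [DecidableEq ι] (A : Matrix ι ι ℝ) (x : ι → ℝ) :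
    sigmaMin A ^ 2 * (x ⬝ᵥ x) ≤ (Aᵀ *ᵥ x) ⬝ᵥ (Aᵀ *ᵥ x) := by
  rcases eq_or_ne (sigmaMin A) 0 with h | h
  · rw [h]
    simpa using zero_le_dotProduct_self _
  have hs : 0 < sigmaMin A ^ 2 := by positivity
  have hu : IsUnit A.det := by
    rw [← isUnit_iff_isUnit_det, ← mulVec_injective_iff_isUnit]
    rw [show A.mulVec = A.mulVecLin from rfl, ← LinearMap.ker_eq_bot, LinearMap.ker_eq_bot']
    intro y hy
    have h1 := le_mulVec_dotProduct_self A y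
    rw [show A *ᵥ y = 0 from hy, dotProduct_zero] at h1
    have h2 := zero_le_dotProduct_self y
    exact dotProduct_self_eq_zero.1 (le_antisymm (by nlinarith) h2)
  set u := A⁻¹ *ᵥ x
  have hx : A *ᵥ u = x := by rw [mulVec_mulVec, mul_nonsing_inv _ hu, one_mulVec]
  have h1 : x ⬝ᵥ x = (Aᵀ *ᵥ x) ⬝ᵥ u := by
    rw [mulVec_transpose, ← dotProduct_mulVec, hx]
  have h2 := le_mulVec_dotProduct_self A u
  rw [hx] at h2
  have h3 := dotProduct_sq_le (Aᵀ *ᵥ x) u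
  rw [← h1] at h3
  have hp := zero_le_dotProduct_self (Aᵀ *ᵥ x)
  rcases (zero_le_dotProduct_self x).eq_or_lt with h0 | h0
  · rw [← h0, mul_zero]; exact hp
  · refine le_of_mul_le_mul_right ?_ h0
    nlinarith [mul_le_mul_of_nonneg_left h2 hp, mul_le_mul_of_nonneg_left h3 hs.le]

/-- The trace of a matrix which acts as `g σ²` on the eigenvectors of `Jᵀ * J`, in terms of the
singular values of `J`. -/
theorem trace_eq_sum_singularValues {m n : ℕ} (hmn : m ≤ n) (J : Matrix (Fin m) (Fin n) ℝ)
    (B : Matrix (Fin n) (Fin n) ℝ) (g : ℝ → ℝ) (g0 : g 0 = 0)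
    (hB : ∀ (t : ℝ) (v : Fin n → ℝ), 0 ≤ t → (Jᵀ * J) *ᵥ v = t • v → B *ᵥ v = g t • v) :
    B.trace = ∑ a : Fin m, g (matrixSingularValue J a ^ 2) := by
  set T := toEuclideanLin J with hTdef
  have hn : Module.finrank ℝ (EuclideanSpace ℝ (Fin n)) = n := by simp
  set hT := T.isSymmetric_adjoint_comp_self
  set b := hT.eigenvectorBasis hn
  have h1 : B.trace = ∑ i : Fin n, g (T.singularValues i ^ 2) := by
    have htr : B.trace = LinearMap.trace ℝ _ (toEuclideanLin B) := by
      rw [show toEuclideanLin B = toLin (PiLp.basisFun 2 ℝ (Fin n)) (PiLp.basisFun 2 ℝ (Fin n)) B by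
          rw [← toLpLin_eq_toLin], LinearMap.trace_eq_matrix_trace ℝ
        (PiLp.basisFun 2 ℝ (Fin n)), LinearMap.toMatrix_toLin]
    rw [htr, LinearMap.trace_eq_sum_inner _ b]
    refine Finset.sum_congr rfl fun i _ => ?_
    have hv : (LinearMap.adjoint T ∘ₗ T) (b i) = (T.singularValues i ^ 2) • b i := by
      rw [T.sq_singularValues_fin hn]
      exact hT.apply_eigenvectorBasis hn i
    have hv' : (Jᵀ * J) *ᵥ (b i).ofLp = (T.singularValues i ^ 2) • (b i).ofLp := by
      have := congrArg WithLp.ofLp hv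
      rw [hTdef, ← toEuclideanLin_conjTranspose_eq_adjoint] at this
      simpa [mulVec_mulVec] using this
    have h2 := hB _ _ (sq_nonneg _) hv'
    have h3 : toEuclideanLin B (b i) = g (T.singularValues i ^ 2) • b i := by
      apply WithLp.ofLp_injective
      simpa using h2
    rw [h3, inner_smul_right, real_inner_self_eq_norm_sq, b.norm_eq_one]
    simp
  rw [h1, Fin.sum_univ_eq_sum_range (fun i => g (T.singularValues i ^ 2)) n]
  have h2 : ∑ a : Fin m, g (matrixSingularValue J a ^ 2)
      = ∑ i ∈ Finset.range m, g (T.singularValues i ^ 2) :=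
    Fin.sum_univ_eq_sum_range (fun i => g (T.singularValues i ^ 2)) m
  rw [h2]
  symm
  -- The rank of J is at most m, so the singular values from index m on are zero and contribute g 0
  -- = 0.
  refine Finset.sum_subset (Finset.range_mono hmn) fun i _ hi => ?_
  have hr : Module.finrank ℝ T.range ≤ i := by
    have := Submodule.finrank_le T.range
    rw [finrank_euclideanSpace_fin] at this
    exact this.trans (not_lt.1 fun h => hi (Finset.mem_range.2 h))
  rw [T.singularValues_eq_zero_iff_le_finrank_range.2 hr]
  simpa using g0

end Matrix

/-! ### Gram matrices of the regularized factors -/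

namespace Matrix

theorem posDef_transpose_mul_self_add_smul_one {m n : ℕ} (X : Matrix (Fin m) (Fin n) ℝ) {w : ℝ}
    (hw : 0 < w) : (Xᵀ * X + w ^ 2 • (1 : Matrix (Fin n) (Fin n) ℝ)).PosDef := by
  have h1 : (Xᵀ * X).PosSemidef := by
    simpa only [conjTranspose_eq_transpose_of_trivial] using posSemidef_conjTranspose_mul_self X
  exact PosDef.posSemidef_add h1 (PosDef.one.smul (by positivity : 0 < w ^ 2))

theorem mul_inv_mul_transpose_self {m n : ℕ} (X : Matrix (Fin m) (Fin n) ℝ)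
    {W R : Matrix (Fin n) (Fin n) ℝ} (h : W = Rᵀ * R) :
    (X * R⁻¹) * (X * R⁻¹)ᵀ = X * W⁻¹ * Xᵀ := by
  rw [h, mul_inv_rev, transpose_mul, transpose_nonsing_inv]
  simp only [Matrix.mul_assoc]

/-- Push-through identity: Q Qᵀ = 1 gives (JᵀJ + w²)Qᵀ = Qᵀ(KᵀK + w²), hence the same intertwining
for the inverses. -/
theorem mul_resolvent_mul_transpose {m n : ℕ} {J : Matrix (Fin m) (Fin n) ℝ}
    {K : Matrix (Fin m) (Fin m) ℝ} {Q : Matrix (Fin m) (Fin n) ℝ} (hJ : J = K * Q)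
    (hQ : Q * Qᵀ = 1) {w : ℝ} (hw : 0 < w) :
    J * (Jᵀ * J + w ^ 2 • (1 : Matrix (Fin n) (Fin n) ℝ))⁻¹ * Jᵀ
      = K * (Kᵀ * K + w ^ 2 • (1 : Matrix (Fin m) (Fin m) ℝ))⁻¹ * Kᵀ := by
  have hW := (isUnit_iff_isUnit_det _).1 (posDef_transpose_mul_self_add_smul_one J hw).isUnit
  have hV := (isUnit_iff_isUnit_det _).1 (posDef_transpose_mul_self_add_smul_one K hw).isUnit
  set W := Jᵀ * J + w ^ 2 • (1 : Matrix (Fin n) (Fin n) ℝ) with hWd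
  set V := Kᵀ * K + w ^ 2 • (1 : Matrix (Fin m) (Fin m) ℝ) with hVd
  have h1 : W * Qᵀ = Qᵀ * V := by
    rw [hWd, hVd, hJ, transpose_mul, Matrix.add_mul, Matrix.mul_add]
    congr 1
    · simp only [Matrix.mul_assoc, hQ, Matrix.mul_one]
    · simp
  have h2 : W⁻¹ * Qᵀ = Qᵀ * V⁻¹ := by
    calc W⁻¹ * Qᵀ = W⁻¹ * (Qᵀ * V) * V⁻¹ := by
          rw [Matrix.mul_assoc, Matrix.mul_assoc, mul_nonsing_inv _ hV, Matrix.mul_one]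
      _ = Qᵀ * V⁻¹ := by rw [← h1, ← Matrix.mul_assoc, nonsing_inv_mul _ hW, Matrix.one_mul]
  have h3 : Jᵀ = Qᵀ * Kᵀ := by rw [hJ, transpose_mul]
  calc J * W⁻¹ * Jᵀ = K * Q * (W⁻¹ * Qᵀ) * Kᵀ := by
        rw [h3, ← hJ]; simp only [Matrix.mul_assoc]
    _ = K * (Q * Qᵀ) * V⁻¹ * Kᵀ := by rw [h2]; simp only [Matrix.mul_assoc]
    _ = K * V⁻¹ * Kᵀ := by rw [hQ, Matrix.mul_one]

theorem sum_eq_add_sum_subtype_lt {m : ℕ} (a : Fin m) (f : Fin m → ℝ)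
    (hf : ∀ i, i < a → f i = 0) : ∑ i, f i = f a + ∑ i : {i : Fin m // a < i}, f i := by
  rw [← Finset.add_sum_erase _ _ (Finset.mem_univ a)]
  congr 1
  rw [← Finset.sum_subtype (Finset.univ.filter (a < ·)) (by simp) f]
  symm
  refine Finset.sum_subset (fun i hi => ?_) fun i hi hi' => ?_
  · simp only [Finset.mem_filter, Finset.mem_univ, true_and] at hi
    simp [hi.ne']
  · refine hf i (lt_of_le_of_ne (not_lt.1 fun h => hi' (by simpa using h)) ?_)
    exact Finset.ne_of_mem_erase hi

end Matrix

/-! ### The reverse Cholesky diagonal as a minimum -/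

section Factor

variable {m : ℕ} {K L : Matrix (Fin m) (Fin m) ℝ} {w : ℝ}

/-- Only the zero-column condition needs an argument. If column a of K vanishes, column a of LᵀL is
w² times a unit vector, so column a of L = L⁻ᵀ(LᵀL) is a multiple of a column of the upper
triangular L⁻ᵀ. Being also lower triangular, it has only its diagonal entry, and column a of K = (K
L⁻¹)L is L a a times that of K L⁻¹. -/
theorem IsReverseCholeskyFactor.isReducedQR_mul_inv (hK : ∀ i j, i < j → K i j = 0)
    (hK0 : ∀ a, 0 ≤ K a a) (hKc : ∀ a, K a a = 0 → ∀ i, K i a = 0)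
    (hL : IsReverseCholeskyFactor (Kᵀ * K + w ^ 2 • (1 : Matrix (Fin m) (Fin m) ℝ)) L) :
    (∀ i j, i < j → (K * L⁻¹) i j = 0) ∧ (∀ a, (K * L⁻¹) a a = K a a / L a a) ∧
      (∀ a, 0 ≤ (K * L⁻¹) a a) ∧ ∀ a, (K * L⁻¹) a a = 0 → ∀ i, (K * L⁻¹) i a = 0 := by
  have hLd : ∀ i, L i i ≠ 0 := fun i => (hL.diag_pos i).ne'
  have hLi := inv_lower hL.lower hLd
  have hLu := isUnit_det_of_lower hL.lower hLd
  have hdiag : ∀ a, (K * L⁻¹) a a = K a a / L a a := fun a => by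
    rw [mul_apply_self_of_lower hK hLi, inv_apply_self_of_lower hL.lower hLd, div_eq_mul_inv]
  refine ⟨mul_lower hK hLi, hdiag, fun a => ?_, fun a ha => ?_⟩
  · rw [hdiag]
    exact div_nonneg (hK0 a) (hL.diag_pos a).le
  · rw [hdiag, div_eq_zero_iff, or_iff_left (hLd a)] at ha
    have hcol := hKc a ha
    have hM : ∀ k, (Kᵀ * K + w ^ 2 • (1 : Matrix (Fin m) (Fin m) ℝ)) k a
        = w ^ 2 * (1 : Matrix (Fin m) (Fin m) ℝ) k a := fun k => by
      rw [Matrix.add_apply, Matrix.smul_apply, mul_apply, smul_eq_mul, add_eq_right]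
      exact Finset.sum_eq_zero fun i _ => by rw [hcol i, mul_zero]
    have hLa : ∀ i, i ≠ a → L i a = 0 := by
      intro i hi
      rcases lt_or_gt_of_ne hi with h | h
      · exact hL.lower i a h
      · have hLu' : IsUnit Lᵀ.det := by rwa [det_transpose]
        have e : L = (L⁻¹)ᵀ * (Kᵀ * K + w ^ 2 • (1 : Matrix (Fin m) (Fin m) ℝ)) := by
          rw [hL.eq_mul, transpose_nonsing_inv, ← Matrix.mul_assoc, nonsing_inv_mul _ hLu',
            Matrix.one_mul]
        rw [e, mul_apply]
        refine Finset.sum_eq_zero fun k _ => ?_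
        rw [hM, transpose_apply]
        rcases eq_or_ne k a with rfl | hk
        · rw [hLi _ _ h, zero_mul]
        · rw [one_apply_ne hk, mul_zero, mul_zero]
    intro i
    have e : (K * L⁻¹ * L) i a = K i a := by
      rw [Matrix.mul_assoc, nonsing_inv_mul _ hLu, Matrix.mul_one]
    rw [mul_apply, Finset.sum_eq_single a (fun k _ hk => by rw [hLa k hk, mul_zero]) (by simp),
      hcol i] at e
    exact (mul_eq_zero.1 e).resolve_right (hLd a)

/-- The vector with entries zero before `a`, one at `a`, and `y` after `a`. -/
def extendOne (a : Fin m) (y : {i : Fin m // a < i} → ℝ) : Fin m → ℝ :=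
  fun i => if h : a < i then y ⟨i, h⟩ else if i = a then 1 else 0

theorem extendOne_of_lt (a : Fin m) (y : {i : Fin m // a < i} → ℝ) {i : Fin m} (h : i < a) :
    extendOne a y i = 0 := by
  simp [extendOne, h.not_gt, h.ne]

theorem extendOne_self (a : Fin m) (y : {i : Fin m // a < i} → ℝ) : extendOne a y a = 1 := by
  simp [extendOne]

theorem extendOne_val (a : Fin m) (y : {i : Fin m // a < i} → ℝ) (i : {i : Fin m // a < i}) :
    extendOne a y i = y i := by
  simp [extendOne, i.2]

theorem mulVec_extendOne (A : Matrix (Fin m) (Fin m) ℝ) (a : Fin m)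
    (y : {i : Fin m // a < i} → ℝ) (i : Fin m) :
    (A *ᵥ extendOne a y) i = A i a + ∑ j : {i : Fin m // a < i}, A i j * y j := by
  rw [mulVec, dotProduct, sum_eq_add_sum_subtype_lt a _
    (fun j hj => by rw [extendOne_of_lt a y hj, mul_zero]), extendOne_self, mul_one]
  simp only [extendOne_val]

theorem mulVec_extendOne_self (hL : ∀ i j, i < j → L i j = 0) (a : Fin m)
    (y : {i : Fin m // a < i} → ℝ) : (L *ᵥ extendOne a y) a = L a a := by
  rw [mulVec_extendOne, add_eq_left]
  exact Finset.sum_eq_zero fun j _ => by rw [hL a j j.2, zero_mul]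

theorem dotProduct_mulVec_extendOne (hK : ∀ i j, i < j → K i j = 0) (a : Fin m)
    (y : {i : Fin m // a < i} → ℝ) :
    (K *ᵥ extendOne a y) ⬝ᵥ (K *ᵥ extendOne a y) = K a a ^ 2 +
      ((fun i : {i : Fin m // a < i} => K i a) + trailingBlock K a *ᵥ y) ⬝ᵥ
        ((fun i : {i : Fin m // a < i} => K i a) + trailingBlock K a *ᵥ y) := by
  rw [dotProduct, sum_eq_add_sum_subtype_lt a]
  · rw [mulVec_extendOne_self hK, ← sq]
    congr 1
    refine Finset.sum_congr rfl fun i _ => ?_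
    rw [mulVec_extendOne]
    rfl
  · intro i hi
    rw [mulVec_extendOne, hK i a hi, Finset.sum_eq_zero, add_zero, mul_zero]
    exact fun j _ => by rw [hK i j (hi.trans j.2), zero_mul]

theorem IsReverseCholeskyFactor.dotProduct_mulVec_extendOne (hK : ∀ i j, i < j → K i j = 0)
    (hL : IsReverseCholeskyFactor (Kᵀ * K + w ^ 2 • (1 : Matrix (Fin m) (Fin m) ℝ)) L)
    (a : Fin m) (y : {i : Fin m // a < i} → ℝ) :
    (L *ᵥ extendOne a y) ⬝ᵥ (L *ᵥ extendOne a y) = K a a ^ 2 + w ^ 2 +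
      (((fun i : {i : Fin m // a < i} => K i a) + trailingBlock K a *ᵥ y) ⬝ᵥ
        ((fun i : {i : Fin m // a < i} => K i a) + trailingBlock K a *ᵥ y)
        + w ^ 2 * (y ⬝ᵥ y)) := by
  have gram : ∀ (A : Matrix (Fin m) (Fin m) ℝ) (v : Fin m → ℝ),
      (A *ᵥ v) ⬝ᵥ (A *ᵥ v) = v ⬝ᵥ ((Aᵀ * A) *ᵥ v) := fun A v => by
    rw [← mulVec_mulVec, dotProduct_mulVec v, vecMul_transpose]
  have hv : extendOne a y ⬝ᵥ extendOne a y = 1 + y ⬝ᵥ y := by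
    rw [dotProduct, sum_eq_add_sum_subtype_lt a _
      (fun j hj => by rw [extendOne_of_lt a y hj, mul_zero]), extendOne_self, mul_one]
    simp only [extendOne_val]
    rfl
  rw [gram, ← hL.eq_mul, add_mulVec, dotProduct_add, ← gram, _root_.dotProduct_mulVec_extendOne hK,
    smul_mulVec, one_mulVec, dotProduct_smul, hv, smul_eq_mul]
  ring

/-- Entry a of L v is L a a for every admissible v, so its square is at most ‖Lv‖². -/
theorem IsReverseCholeskyFactor.sq_diag_le (hK : ∀ i j, i < j → K i j = 0)
    (hL : IsReverseCholeskyFactor (Kᵀ * K + w ^ 2 • (1 : Matrix (Fin m) (Fin m) ℝ)) L)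
    (a : Fin m) (y : {i : Fin m // a < i} → ℝ) :
    L a a ^ 2 ≤ K a a ^ 2 + w ^ 2 +
      (((fun i : {i : Fin m // a < i} => K i a) + trailingBlock K a *ᵥ y) ⬝ᵥ
        ((fun i : {i : Fin m // a < i} => K i a) + trailingBlock K a *ᵥ y)
        + w ^ 2 * (y ⬝ᵥ y)) := by
  rw [← hL.dotProduct_mulVec_extendOne hK, ← mulVec_extendOne_self hL.lower a y, dotProduct, sq]
  exact Finset.single_le_sum (f := fun i => (L *ᵥ extendOne a y) i * (L *ᵥ extendOne a y) i)
    (fun i _ => mul_self_nonneg _) (Finset.mem_univ a)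

theorem IsReverseCholeskyFactor.exists_sq_diag_eq (hK : ∀ i j, i < j → K i j = 0)
    (hL : IsReverseCholeskyFactor (Kᵀ * K + w ^ 2 • (1 : Matrix (Fin m) (Fin m) ℝ)) L)
    (a : Fin m) : ∃ y : {i : Fin m // a < i} → ℝ,
    L a a ^ 2 = K a a ^ 2 + w ^ 2 +
      (((fun i : {i : Fin m // a < i} => K i a) + trailingBlock K a *ᵥ y) ⬝ᵥ
        ((fun i : {i : Fin m // a < i} => K i a) + trailingBlock K a *ᵥ y)
        + w ^ 2 * (y ⬝ᵥ y)) := by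
  have hLd : ∀ i, L i i ≠ 0 := fun i => (hL.diag_pos i).ne'
  -- Equality requires Lv to be L a a times the a-th unit vector. The solution v has entry 1 at a
  -- and zeros before, because L⁻¹ is lower triangular with inverse diagonal.
  refine ⟨fun i => L⁻¹ i a * L a a, ?_⟩
  have hv : extendOne a (fun i : {i : Fin m // a < i} => L⁻¹ i a * L a a)
      = L⁻¹ *ᵥ Pi.single a (L a a) := by
    ext i
    rw [mulVec_single]
    rcases lt_trichotomy i a with h | rfl | h
    · rw [extendOne_of_lt _ _ h]
      simp [inv_lower hL.lower hLd _ _ h]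
    · rw [extendOne_self]
      simp [inv_apply_self_of_lower hL.lower hLd, hLd]
    · rw [extendOne_val a _ ⟨i, h⟩]
      simp [mul_comm]
  rw [← hL.dotProduct_mulVec_extendOne hK, hv, mulVec_mulVec,
    mul_nonsing_inv _ (isUnit_det_of_lower hL.lower hLd), one_mulVec]
  simp [sq]

end Factor

/-! ### Regularized least squares -/

section LeastSquares

variable {ι : Type*} [Fintype ι] [DecidableEq ι] {w : ℝ}

/-- With residual u = d + Ay and s = `sigmaMax A`, this is w²‖u − Ay‖² ≤ (s² + w²)(‖u‖² + w²‖y‖²).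
-/
theorem le_regularized_leastSquares (hw : 0 < w) (A : Matrix ι ι ℝ) (d y : ι → ℝ) :
    w ^ 2 * (d ⬝ᵥ d) / (sigmaMax A ^ 2 + w ^ 2) ≤
      (d + A *ᵥ y) ⬝ᵥ (d + A *ᵥ y) + w ^ 2 * (y ⬝ᵥ y) := by
  rw [div_le_iff₀ (by positivity)]
  obtain ⟨u, hu⟩ : ∃ u, u = d + A *ᵥ y := ⟨_, rfl⟩
  have hd : d = u - A *ᵥ y := by rw [hu, add_sub_cancel_right]
  have h1 := mulVec_dotProduct_self_le A y
  have h2 := dotProduct_sq_le u (A *ᵥ y)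
  rw [← hu, hd]
  simp only [sub_dotProduct, dotProduct_sub, dotProduct_comm (A *ᵥ y) u]
  have hu0 := zero_le_dotProduct_self u
  have hy0 := zero_le_dotProduct_self y
  set p := u ⬝ᵥ u
  set q := (A *ᵥ y) ⬝ᵥ (A *ᵥ y)
  set r := u ⬝ᵥ (A *ᵥ y)
  set t := y ⬝ᵥ y
  set s := sigmaMax A
  -- Cauchy–Schwarz gives r² ≤ s²pt, and the arithmetic–geometric mean inequality for s²p and w⁴t
  -- bounds the cross term.
  have h3 : |2 * w ^ 2 * r| ≤ s ^ 2 * p + w ^ 4 * t := by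
    refine abs_le_of_sq_le_sq ?_ (by positivity)
    have h4 : r ^ 2 ≤ p * (s ^ 2 * t) := h2.trans (by gcongr)
    have h5 : w ^ 4 * r ^ 2 ≤ w ^ 4 * (p * (s ^ 2 * t)) := by gcongr
    nlinarith [sq_nonneg (s ^ 2 * p - w ^ 4 * t)]
  have h6 := (abs_le.1 h3).1
  have h7 : w ^ 2 * q ≤ w ^ 2 * (s ^ 2 * t) := by gcongr
  nlinarith

/-- The minimizer is y = −Aᵀz with (A Aᵀ + w²)z = d; the residual is w²z and the value is w²⟨d, z⟩.
-/
theorem exists_regularized_leastSquares_le (hw : 0 < w) (A : Matrix ι ι ℝ) (d : ι → ℝ) :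
    ∃ y : ι → ℝ, (d + A *ᵥ y) ⬝ᵥ (d + A *ᵥ y) + w ^ 2 * (y ⬝ᵥ y) ≤
      w ^ 2 * (d ⬝ᵥ d) / (sigmaMin A ^ 2 + w ^ 2) := by
  have hV : (A * Aᵀ + w ^ 2 • (1 : Matrix ι ι ℝ)).PosDef := by
    have h1 : (A * Aᵀ).PosSemidef := by
      simpa only [conjTranspose_eq_transpose_of_trivial] using posSemidef_self_mul_conjTranspose A
    exact PosDef.posSemidef_add h1 (PosDef.one.smul (by positivity : 0 < w ^ 2))
  have hu := (isUnit_iff_isUnit_det _).1 hV.isUnit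
  obtain ⟨z, hz⟩ : ∃ z, A *ᵥ (Aᵀ *ᵥ z) + w ^ 2 • z = d := by
    refine ⟨(A * Aᵀ + w ^ 2 • (1 : Matrix ι ι ℝ))⁻¹ *ᵥ d, ?_⟩
    have h := mulVec_mulVec d (A * Aᵀ + w ^ 2 • (1 : Matrix ι ι ℝ))
      (A * Aᵀ + w ^ 2 • (1 : Matrix ι ι ℝ))⁻¹
    rw [mul_nonsing_inv _ hu, one_mulVec, add_mulVec, smul_mulVec, one_mulVec] at h
    rw [mulVec_mulVec, h]
  refine ⟨-(Aᵀ *ᵥ z), ?_⟩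
  have hr : d + A *ᵥ (-(Aᵀ *ᵥ z)) = w ^ 2 • z := by
    rw [mulVec_neg, ← hz]; abel
  have hdz : d ⬝ᵥ z = (Aᵀ *ᵥ z) ⬝ᵥ (Aᵀ *ᵥ z) + w ^ 2 * (z ⬝ᵥ z) := by
    rw [← hz, add_dotProduct, smul_dotProduct, smul_eq_mul]
    congr 1
    rw [dotProduct_comm, dotProduct_mulVec, mulVec_transpose]
  rw [hr, smul_dotProduct, dotProduct_smul, neg_dotProduct, dotProduct_neg, neg_neg,
    smul_eq_mul, smul_eq_mul, le_div_iff₀ (by positivity)]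
  have h1 := le_transpose_mulVec_dotProduct_self A z
  have h2 := dotProduct_sq_le d z
  have h3 := zero_le_dotProduct_self d
  have h4 := zero_le_dotProduct_self z
  set p := d ⬝ᵥ d
  set q := d ⬝ᵥ z
  set t := z ⬝ᵥ z
  set s := sigmaMin A
  set r := (Aᵀ *ᵥ z) ⬝ᵥ (Aᵀ *ᵥ z)
  have hq : (s ^ 2 + w ^ 2) * t ≤ q := by rw [hdz]; linarith
  have hk : 0 < s ^ 2 + w ^ 2 := by positivity
  -- Combine (s² + w²)‖z‖² ≤ ⟨d, z⟩ with ⟨d, z⟩² ≤ ‖d‖²‖z‖² and cancel one factor ⟨d, z⟩.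
  have hmain : q * (s ^ 2 + w ^ 2) ≤ p := by
    have hq0 : 0 ≤ q := le_trans (by positivity) hq
    rcases hq0.eq_or_lt with h0 | h0
    · rw [← h0, zero_mul]; exact h3
    · refine le_of_mul_le_mul_right ?_ h0
      nlinarith [mul_le_mul_of_nonneg_left hq h3, mul_le_mul_of_nonneg_left h2 hk.le]
  have : w ^ 2 * (w ^ 2 * t) + w ^ 2 * r = w ^ 2 * q := by rw [hdz]; ring
  rw [this, mul_assoc]
  gcongr

end LeastSquares

/-! ### Bounds on the diagonal entries -/

section Bounds

variable {m : ℕ} {K L : Matrix (Fin m) (Fin m) ℝ} {w : ℝ}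

theorem belowDiagNormSq_eq_dotProduct (K : Matrix (Fin m) (Fin m) ℝ) (a : Fin m) :
    belowDiagNormSq K a = (fun i : {i : Fin m // a < i} => K i a) ⬝ᵥ
      (fun i : {i : Fin m // a < i} => K i a) :=
  Finset.sum_congr rfl fun _ _ => sq _

theorem belowDiagNormSq_nonneg (K : Matrix (Fin m) (Fin m) ℝ) (a : Fin m) :
    0 ≤ belowDiagNormSq K a :=
  Finset.sum_nonneg fun _ _ => sq_nonneg _

theorem nuLowerSq_nonneg (K : Matrix (Fin m) (Fin m) ℝ) (w : ℝ) (a : Fin m) :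
    0 ≤ nuLowerSq K w a :=
  div_nonneg (mul_nonneg (sq_nonneg _) (belowDiagNormSq_nonneg K a)) (by positivity)

theorem nuUpperSq_nonneg (K : Matrix (Fin m) (Fin m) ℝ) (w : ℝ) (a : Fin m) :
    0 ≤ nuUpperSq K w a :=
  div_nonneg (mul_nonneg (sq_nonneg _) (belowDiagNormSq_nonneg K a)) (by positivity)

theorem IsReverseCholeskyFactor.add_nuLowerSq_le (hw : 0 < w) (hK : ∀ i j, i < j → K i j = 0)
    (hL : IsReverseCholeskyFactor (Kᵀ * K + w ^ 2 • (1 : Matrix (Fin m) (Fin m) ℝ)) L)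
    (a : Fin m) : K a a ^ 2 + w ^ 2 + nuLowerSq K w a ≤ L a a ^ 2 := by
  obtain ⟨y, hy⟩ := hL.exists_sq_diag_eq hK a
  rw [hy, nuLowerSq, belowDiagNormSq_eq_dotProduct]
  gcongr
  exact le_regularized_leastSquares hw _ _ y

theorem IsReverseCholeskyFactor.le_add_nuUpperSq (hw : 0 < w) (hK : ∀ i j, i < j → K i j = 0)
    (hL : IsReverseCholeskyFactor (Kᵀ * K + w ^ 2 • (1 : Matrix (Fin m) (Fin m) ℝ)) L)
    (a : Fin m) : L a a ^ 2 ≤ K a a ^ 2 + w ^ 2 + nuUpperSq K w a := by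
  obtain ⟨y, hy⟩ := exists_regularized_leastSquares_le hw (trailingBlock K a)
    (fun i : {i : Fin m // a < i} => K i a)
  refine (hL.sq_diag_le hK a y).trans ?_
  rw [nuUpperSq, belowDiagNormSq_eq_dotProduct]
  gcongr

theorem IsReverseCholeskyFactor.sq_diag_bounds (hw : 0 < w) (hK : ∀ i j, i < j → K i j = 0)
    (hL : IsReverseCholeskyFactor (Kᵀ * K + w ^ 2 • (1 : Matrix (Fin m) (Fin m) ℝ)) L)
    (a : Fin m) :
    alphaSq K w a ≤ (K a a / L a a) ^ 2 ∧ (K a a / L a a) ^ 2 ≤ betaSq K w a := by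
  have h0 := nuLowerSq_nonneg K w a
  have hp := hL.diag_pos a
  rw [div_pow, alphaSq, betaSq]
  constructor
  · exact div_le_div_of_nonneg_left (sq_nonneg _) (by positivity) (hL.le_add_nuUpperSq hw hK a)
  · exact div_le_div_of_nonneg_left (sq_nonneg _) (by positivity) (hL.add_nuLowerSq_le hw hK a)

theorem betaSq_le (K : Matrix (Fin m) (Fin m) ℝ) (hw : 0 < w) (a : Fin m) :
    betaSq K w a ≤ K a a ^ 2 / (w ^ 2 + K a a ^ 2) := by
  have h0 := nuLowerSq_nonneg K w a
  rw [betaSq]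
  exact div_le_div_of_nonneg_left (sq_nonneg _) (by positivity) (by linarith)

/-- Replacing ν² by ‖d‖² leaves a bound k/(w² + s) with s independent of w, whose behaviour for
large w is explicit. -/
theorem le_alphaSq (K : Matrix (Fin m) (Fin m) ℝ) (hw : 0 < w) (a : Fin m) :
    K a a ^ 2 / (w ^ 2 + (K a a ^ 2 + belowDiagNormSq K a)) ≤ alphaSq K w a := by
  have h0 := nuUpperSq_nonneg K w a
  have h1 : nuUpperSq K w a ≤ belowDiagNormSq K a := by
    rw [nuUpperSq, div_le_iff₀ (by positivity)]
    nlinarith [belowDiagNormSq_nonneg K a, mul_nonneg (belowDiagNormSq_nonneg K a)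
      (sq_nonneg (sigmaMin (trailingBlock K a)))]
  rw [alphaSq]
  exact div_le_div_of_nonneg_left (sq_nonneg _) (by positivity) (by linarith)

end Bounds

/-! ### Consequences for the reduced QR factor -/

namespace IsReducedQR

variable {m n : ℕ} {J : Matrix (Fin m) (Fin n) ℝ} {K : Matrix (Fin m) (Fin m) ℝ}
  {Q : Matrix (Fin m) (Fin n) ℝ}

theorem factor_ne_zero (h : IsReducedQR J K Q) (hJ : J ≠ 0) : K ≠ 0 := by
  rintro rfl
  exact hJ (by rw [h.eq_mul, Matrix.zero_mul])

theorem mul_transpose_self (h : IsReducedQR J K Q) : J * Jᵀ = K * Kᵀ := by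
  rw [h.eq_mul, transpose_mul, Matrix.mul_assoc, ← Matrix.mul_assoc Q, h.orthonormal_rows,
    Matrix.one_mul]

/-- The factor of the regularized matrix, through the reverse Cholesky factor. -/
theorem eq_mul_inv (h : IsReducedQR J K Q) {w : ℝ} (hw : 0 < w) {R : Matrix (Fin n) (Fin n) ℝ}
    (hR : IsCholeskyFactor (Jᵀ * J + w ^ 2 • (1 : Matrix (Fin n) (Fin n) ℝ)) R)
    {C : Matrix (Fin m) (Fin m) ℝ} {P : Matrix (Fin m) (Fin n) ℝ}
    (hC : IsReducedQR (J * R⁻¹) C P) {L : Matrix (Fin m) (Fin m) ℝ}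
    (hL : IsReverseCholeskyFactor (Kᵀ * K + w ^ 2 • (1 : Matrix (Fin m) (Fin m) ℝ)) L) :
    C = K * L⁻¹ := by
  obtain ⟨h1, -, h2, h3⟩ := hL.isReducedQR_mul_inv h.lower h.diag_nonneg h.column_zero
  refine eq_of_mul_transpose_eq_of_lower hC.lower hC.diag_nonneg hC.column_zero h1 h2 h3 ?_
  rw [← hC.mul_transpose_self, mul_inv_mul_transpose_self _ hR.eq_mul,
    mul_resolvent_mul_transpose h.eq_mul h.orthonormal_rows hw,
    mul_inv_mul_transpose_self _ hL.eq_mul]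

theorem sq_diag_bounds (h : IsReducedQR J K Q) {w : ℝ} (hw : 0 < w)
    {R : Matrix (Fin n) (Fin n) ℝ}
    (hR : IsCholeskyFactor (Jᵀ * J + w ^ 2 • (1 : Matrix (Fin n) (Fin n) ℝ)) R)
    {C : Matrix (Fin m) (Fin m) ℝ} {P : Matrix (Fin m) (Fin n) ℝ}
    (hC : IsReducedQR (J * R⁻¹) C P) (a : Fin m) :
    alphaSq K w a ≤ C a a ^ 2 ∧ C a a ^ 2 ≤ betaSq K w a := by
  obtain ⟨L, hL⟩ := (posDef_transpose_mul_self_add_smul_one K hw).exists_isReverseCholeskyFactor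
  rw [h.eq_mul_inv hw hR hC hL,
    (hL.isReducedQR_mul_inv h.lower h.diag_nonneg h.column_zero).2.1]
  exact hL.sq_diag_bounds hw h.lower a

/-- From J = KQ the rank of K is at least m, so the product of its diagonal entries, its
determinant, is nonzero. -/
theorem diag_ne_zero_of_rank_eq (h : IsReducedQR J K Q) (hr : J.rank = m) (a : Fin m) :
    K a a ≠ 0 := by
  have h1 : K.rank = Fintype.card (Fin m) := by
    refine le_antisymm (rank_le_card_width K) ?_
    rw [Fintype.card_fin]
    calc m = J.rank := hr.symm
      _ = (K * Q).rank := by rw [← h.eq_mul]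
      _ ≤ K.rank := rank_mul_le_left K Q
  have hu : IsUnit K := by
    rw [← mulVec_surjective_iff_isUnit]
    have : LinearMap.range K.mulVecLin = ⊤ := by
      apply Submodule.eq_top_of_finrank_eq
      rw [Module.finrank_fintype_fun_eq_card]
      exact h1
    exact LinearMap.range_eq_top.1 this
  have hd := ((isUnit_iff_isUnit_det K).1 hu).ne_zero
  rw [det_of_isLowerTriangular K (fun i j hij => h.lower i j hij)] at hd
  exact Finset.prod_ne_zero_iff.1 hd a (Finset.mem_univ a)

end IsReducedQR

/-! ### Frobenius norms as sums over singular values -/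

section Frobenius

variable {m n : ℕ}

theorem sum_sq_eq_trace (C : Matrix (Fin m) (Fin m) ℝ) :
    ∑ a, ∑ b, C a b ^ 2 = (C * Cᵀ).trace := by
  simp [trace, mul_apply, sq]

theorem sum_sq_pos {C : Matrix (Fin m) (Fin m) ℝ} (hC : C ≠ 0) : 0 < ∑ a, ∑ b, C a b ^ 2 := by
  obtain ⟨i, j, hij⟩ : ∃ i j, C i j ≠ 0 := by
    by_contra! h
    exact hC (by ext i j; exact h i j)
  refine Finset.sum_pos' (fun a _ => Finset.sum_nonneg fun b _ => sq_nonneg _)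
    ⟨i, Finset.mem_univ i, Finset.sum_pos' (fun b _ => sq_nonneg _)
      ⟨j, Finset.mem_univ j, by positivity⟩⟩

theorem sum_sq_diag_le_sum_sq (C : Matrix (Fin m) (Fin m) ℝ) :
    ∑ a, C a a ^ 2 ≤ ∑ a, ∑ b, C a b ^ 2 :=
  Finset.sum_le_sum fun a _ =>
    Finset.single_le_sum (f := fun b => C a b ^ 2) (fun _ _ => sq_nonneg _) (Finset.mem_univ a)

/-- By cyclicity this is the trace of (JᵀJ + w²)⁻¹JᵀJ, which acts as t/(t + w²) on an eigenvector of
JᵀJ with eigenvalue t. -/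
theorem trace_resolvent_eq_rhoSq (hmn : m ≤ n) (J : Matrix (Fin m) (Fin n) ℝ) {w : ℝ}
    (hw : 0 < w) :
    (J * (Jᵀ * J + w ^ 2 • (1 : Matrix (Fin n) (Fin n) ℝ))⁻¹ * Jᵀ).trace = rhoSq J w := by
  have hu := (isUnit_iff_isUnit_det _).1 (posDef_transpose_mul_self_add_smul_one J hw).isUnit
  rw [Matrix.mul_assoc, trace_mul_comm, Matrix.mul_assoc]
  refine trace_eq_sum_singularValues hmn J _ (fun t => t / (t + w ^ 2)) (by simp) ?_
  intro t v ht hv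
  set W := Jᵀ * J + w ^ 2 • (1 : Matrix (Fin n) (Fin n) ℝ) with hW
  have h1 : W *ᵥ v = (t + w ^ 2) • v := by
    rw [hW, add_mulVec, hv, smul_mulVec, one_mulVec, add_smul]
  have h2 : v = (t + w ^ 2) • (W⁻¹ *ᵥ v) := by
    rw [← mulVec_smul, ← h1, mulVec_mulVec, nonsing_inv_mul _ hu, one_mulVec]
  have h3 : t + w ^ 2 ≠ 0 := by positivity
  have h4 : W⁻¹ *ᵥ v = (t + w ^ 2)⁻¹ • v := by
    conv_rhs => rw [h2]
    rw [smul_smul, inv_mul_cancel₀ h3, one_smul]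
  rw [← mulVec_mulVec, hv, mulVec_smul, h4, smul_smul, div_eq_mul_inv]

theorem IsReducedQR.sum_sq_eq_rhoSq (hmn : m ≤ n) {J : Matrix (Fin m) (Fin n) ℝ} {w : ℝ}
    (hw : 0 < w) {R : Matrix (Fin n) (Fin n) ℝ}
    (hR : IsCholeskyFactor (Jᵀ * J + w ^ 2 • (1 : Matrix (Fin n) (Fin n) ℝ)) R)
    {C : Matrix (Fin m) (Fin m) ℝ} {P : Matrix (Fin m) (Fin n) ℝ}
    (hC : IsReducedQR (J * R⁻¹) C P) : ∑ a, ∑ b, C a b ^ 2 = rhoSq J w := by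
  rw [sum_sq_eq_trace, ← hC.mul_transpose_self, mul_inv_mul_transpose_self _ hR.eq_mul,
    trace_resolvent_eq_rhoSq hmn J hw]

theorem IsReducedQR.sum_sq_eq_sum_singularValues (hmn : m ≤ n) {J : Matrix (Fin m) (Fin n) ℝ}
    {K : Matrix (Fin m) (Fin m) ℝ} {Q : Matrix (Fin m) (Fin n) ℝ} (h : IsReducedQR J K Q) :
    ∑ a, ∑ b, K a b ^ 2 = ∑ a : Fin m, matrixSingularValue J a ^ 2 := by
  rw [sum_sq_eq_trace, ← h.mul_transpose_self, trace_mul_comm]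
  exact trace_eq_sum_singularValues hmn J _ id rfl fun t v _ hv => hv

theorem rhoSq_le (J : Matrix (Fin m) (Fin n) ℝ) (w : ℝ) : rhoSq J w ≤ m := by
  calc rhoSq J w ≤ ∑ _a : Fin m, (1 : ℝ) :=
        Finset.sum_le_sum fun a _ => div_le_one_of_le₀ (by nlinarith) (by positivity)
    _ = m := by simp

end Frobenius

/-! ### Limits for large and small w -/

section Limits

theorem tendsto_sq_mul_div_sq_add (k s : ℝ) :
    Tendsto (fun w : ℝ => w ^ 2 * (k / (w ^ 2 + s))) atTop (𝓝 k) := by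
  have h0 : Tendsto (fun w : ℝ => w ^ 2 + s) atTop atTop :=
    tendsto_atTop_add_const_right _ _ (tendsto_pow_atTop two_ne_zero)
  have h1 : Tendsto (fun w : ℝ => k - k * s / (w ^ 2 + s)) atTop (𝓝 (k - 0)) :=
    tendsto_const_nhds.sub (h0.const_div_atTop _)
  rw [sub_zero] at h1
  refine h1.congr' ?_
  filter_upwards [h0.eventually_gt_atTop 0] with w hw
  field_simp
  ring

theorem tendsto_sq_mul_rhoSq {m n : ℕ} (J : Matrix (Fin m) (Fin n) ℝ) :
    Tendsto (fun w => w ^ 2 * rhoSq J w) atTop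
      (𝓝 (∑ a : Fin m, matrixSingularValue J a ^ 2)) := by
  simp only [rhoSq, Finset.mul_sum]
  refine tendsto_finsetSum _ fun a _ => ?_
  refine (tendsto_sq_mul_div_sq_add _ (matrixSingularValue J a ^ 2)).congr fun w => ?_
  rw [add_comm (w ^ 2)]

theorem sigmaMin_ne_zero {ι : Type*} [Fintype ι] [DecidableEq ι] [Nonempty ι]
    {A : Matrix ι ι ℝ} (hA : A.det ≠ 0) : sigmaMin A ≠ 0 := by
  have hinj : Function.Injective (toEuclideanLin A) := by
    intro x y hxy
    have h : A *ᵥ x.ofLp = A *ᵥ y.ofLp := by simpa using congrArg WithLp.ofLp hxy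
    exact WithLp.ofLp_injective _
      (mulVec_injective_iff_isUnit.2 ((isUnit_iff_isUnit_det A).2 hA.isUnit) h)
  have := (LinearMap.injective_iff_forall_lt_finrank_singularValues_pos _).1 hinj
    (Fintype.card ι - 1)
  rw [finrank_euclideanSpace] at this
  exact (this (Nat.sub_lt Fintype.card_pos one_pos)).ne'

/-- The trailing block is invertible, so its smallest singular value keeps the denominator nonzero
at w = 0 and the expression is continuous there. For the last index the block is empty and ν² is
identically zero. -/
theorem tendsto_nuUpperSq {m : ℕ} {K : Matrix (Fin m) (Fin m) ℝ}
    (hK : ∀ i j, i < j → K i j = 0) (hd : ∀ a, K a a ≠ 0) (a : Fin m) :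
    Tendsto (fun w => nuUpperSq K w a) (𝓝 0) (𝓝 0) := by
  rcases isEmpty_or_nonempty {i : Fin m // a < i} with h | h
  · simp [nuUpperSq, belowDiagNormSq]
  · have hdet : (trailingBlock K a).det ≠ 0 := by
      rw [det_of_isLowerTriangular (trailingBlock K a) (fun i j hij => hK i j hij)]
      exact Finset.prod_ne_zero_iff.2 fun i _ => hd i
    have hs := sigmaMin_ne_zero hdet
    have hc : ContinuousAt (fun w => nuUpperSq K w a) 0 := by
      unfold nuUpperSq
      refine ContinuousAt.div (by fun_prop) (by fun_prop) ?_
      positivity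
    have := hc.tendsto
    simpa [nuUpperSq] using this

theorem tendsto_alphaSq {m : ℕ} {K : Matrix (Fin m) (Fin m) ℝ}
    (hK : ∀ i j, i < j → K i j = 0) (hd : ∀ a, K a a ≠ 0) (a : Fin m) :
    Tendsto (fun w => alphaSq K w a) (𝓝 0) (𝓝 1) := by
  have h0 : K a a ^ 2 ≠ 0 := pow_ne_zero _ (hd a)
  have h1 : Tendsto (fun w : ℝ => K a a ^ 2 + w ^ 2 + nuUpperSq K w a) (𝓝 0)
      (𝓝 (K a a ^ 2)) := by
    have h2 : Tendsto (fun w : ℝ => K a a ^ 2 + w ^ 2) (𝓝 0) (𝓝 (K a a ^ 2 + 0 ^ 2)) :=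
      (by fun_prop : Continuous fun w : ℝ => K a a ^ 2 + w ^ 2).tendsto 0
    simpa using h2.add (tendsto_nuUpperSq hK hd a)
  have h3 := (tendsto_const_nhds (x := K a a ^ 2)).div h1 h0
  rwa [div_self h0] at h3

end Limits

/-! ### The main theorem -/

theorem theorem3 {m n : ℕ} (hm : 0 < m) (hmn : m ≤ n)
    (Jbar : Matrix (Fin m) (Fin n) ℝ)
    (Cbar : Matrix (Fin m) (Fin m) ℝ) (Jbarhat : Matrix (Fin m) (Fin n) ℝ)
    (hbar : IsReducedQR Jbar Cbar Jbarhat)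
    (R : ℝ → Matrix (Fin n) (Fin n) ℝ)
    (hR : ∀ w : ℝ, 0 < w →
      IsCholeskyFactor (Jbarᵀ * Jbar + w ^ 2 • (1 : Matrix (Fin n) (Fin n) ℝ)) (R w))
    (C : ℝ → Matrix (Fin m) (Fin m) ℝ) (Jhat : ℝ → Matrix (Fin m) (Fin n) ℝ)
    (hC : ∀ w : ℝ, 0 < w → IsReducedQR (Jbar * (R w)⁻¹) (C w) (Jhat w)) :
    -- the factor `C` is `Cbar` times the inverse of the reverse Cholesky factor
    (∀ w : ℝ, 0 < w →
      (∃ Ct, IsReverseCholeskyFactor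
        (Cbarᵀ * Cbar + w ^ 2 • (1 : Matrix (Fin m) (Fin m) ℝ)) Ct) ∧
      ∀ Ct, IsReverseCholeskyFactor
        (Cbarᵀ * Cbar + w ^ 2 • (1 : Matrix (Fin m) (Fin m) ℝ)) Ct → C w = Cbar * Ct⁻¹) ∧
    -- bounds
    (∀ w : ℝ, 0 < w →
      (∀ a, alphaSq Cbar w a ≤ C w a a ^ 2 ∧ C w a a ^ 2 ≤ betaSq Cbar w a) ∧
      (Jbar ≠ 0 → C w ≠ 0 ∧ 0 < rhoSq Jbar w ∧
        1 / rhoSq Jbar w * ∑ a, alphaSq Cbar w a ≤ diagNumber (C w) ∧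
        diagNumber (C w) ≤ 1 / rhoSq Jbar w * ∑ a, betaSq Cbar w a)) ∧
    -- large `w`
    ((∀ a, Tendsto (fun w => C w a a ^ 2) atTop (𝓝 0)) ∧
      (Jbar ≠ 0 → Cbar ≠ 0 ∧
        Tendsto (fun w => diagNumber (C w)) atTop (𝓝 (diagNumber Cbar)))) ∧
    -- small `w`
    (Jbar.rank = m →
      (∀ a, Tendsto (fun w => C w a a ^ 2) (𝓝[>] 0) (𝓝 1)) ∧
      Tendsto (fun w => diagNumber (C w)) (𝓝[>] 0) (𝓝 1)) := by
  have bounds : ∀ w : ℝ, 0 < w → ∀ a, alphaSq Cbar w a ≤ C w a a ^ 2 ∧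
      C w a a ^ 2 ≤ betaSq Cbar w a :=
    fun w hw a => hbar.sq_diag_bounds hw (hR w hw) (hC w hw) a
  have frob : ∀ w : ℝ, 0 < w → ∑ a, ∑ b, C w a b ^ 2 = rhoSq Jbar w :=
    fun w hw => (hC w hw).sum_sq_eq_rhoSq hmn hw (hR w hw)
  -- This rate yields both large-w claims: dividing by w² gives the limit 0, and in the
  -- diagonalization number the factor w² cancels.
  have scaled : ∀ a, Tendsto (fun w => w ^ 2 * C w a a ^ 2) atTop (𝓝 (Cbar a a ^ 2)) := by
    intro a
    refine tendsto_of_tendsto_of_tendsto_of_le_of_le'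
      (tendsto_sq_mul_div_sq_add (Cbar a a ^ 2) (Cbar a a ^ 2 + belowDiagNormSq Cbar a))
      (tendsto_sq_mul_div_sq_add (Cbar a a ^ 2) (Cbar a a ^ 2)) ?_ ?_
    · filter_upwards [eventually_gt_atTop 0] with w hw
      gcongr
      exact (le_alphaSq Cbar hw a).trans (bounds w hw a).1
    · filter_upwards [eventually_gt_atTop 0] with w hw
      gcongr
      exact (bounds w hw a).2.trans (betaSq_le Cbar hw a)
  refine ⟨fun w hw => ⟨(posDef_transpose_mul_self_add_smul_one
    Cbar hw).exists_isReverseCholeskyFactor, fun Ct hCt =>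
    hbar.eq_mul_inv hw (hR w hw) (hC w hw) hCt⟩, fun w hw => ⟨bounds w hw, fun hJ => ?_⟩,
    ⟨fun a => ?_, fun hJ => ⟨hbar.factor_ne_zero hJ, ?_⟩⟩, fun hr => ?_⟩
  · have hRu : IsUnit (R w).det := by
      rw [det_of_isUpperTriangular (fun i j h => (hR w hw).upper i j h)]
      exact (Finset.prod_ne_zero_iff.2 fun i _ => ((hR w hw).diag_pos i).ne').isUnit
    have hJR : Jbar * (R w)⁻¹ ≠ 0 := fun h0 => hJ <| by
      rw [← Matrix.mul_one Jbar, ← nonsing_inv_mul _ hRu, ← Matrix.mul_assoc, h0,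
        Matrix.zero_mul]
    have hCne := (hC w hw).factor_ne_zero hJR
    have hrho : 0 < rhoSq Jbar w := by
      rw [← frob w hw]
      exact sum_sq_pos hCne
    refine ⟨hCne, hrho, ?_, ?_⟩
    · rw [diagNumber, frob w hw, one_div_mul_eq_div]
      gcongr with a
      exact (bounds w hw a).1
    · rw [diagNumber, frob w hw, one_div_mul_eq_div]
      gcongr with a
      exact (bounds w hw a).2
  · have h := (scaled a).div_atTop (tendsto_pow_atTop (α := ℝ) two_ne_zero)
    refine h.congr' ?_
    filter_upwards [eventually_gt_atTop 0] with w hw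
    field_simp
  · have hden := tendsto_sq_mul_rhoSq Jbar
    rw [← hbar.sum_sq_eq_sum_singularValues hmn] at hden
    have h := (tendsto_finsetSum Finset.univ fun a _ => scaled a).div hden
      (sum_sq_pos (hbar.factor_ne_zero hJ)).ne'
    refine h.congr' ?_
    filter_upwards [eventually_gt_atTop 0] with w hw
    rw [diagNumber, frob w hw]
    simp only [Pi.div_apply, ← Finset.mul_sum]
    exact mul_div_mul_left _ _ (by positivity)
  · have hd := hbar.diag_ne_zero_of_rank_eq hr
    have hpos : ∀ᶠ w : ℝ in 𝓝[>] 0, 0 < w := self_mem_nhdsWithin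
    have hdiag : ∀ a, Tendsto (fun w => C w a a ^ 2) (𝓝[>] 0) (𝓝 1) := by
      intro a
      refine tendsto_of_tendsto_of_tendsto_of_le_of_le'
        ((tendsto_alphaSq hbar.lower hd a).mono_left nhdsWithin_le_nhds) tendsto_const_nhds ?_ ?_
      · filter_upwards [hpos] with w hw using (bounds w hw a).1
      · filter_upwards [hpos] with w hw
        exact ((bounds w hw a).2.trans (betaSq_le Cbar hw a)).trans
          (div_le_one_of_le₀ (by nlinarith) (by positivity))
    refine ⟨hdiag, ?_⟩
    have hm' : (0 : ℝ) < m := by exact_mod_cast hm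
    have hsum : Tendsto (fun w => ∑ a, C w a a ^ 2) (𝓝[>] 0) (𝓝 m) := by
      simpa using tendsto_finsetSum Finset.univ fun a _ => hdiag a
    -- Since ρ² ≤ m, this quotient bounds the diagonalization number from below, so the limit of ρ²
    -- is not needed.
    have hlow : Tendsto (fun w => (∑ a, C w a a ^ 2) / m) (𝓝[>] 0) (𝓝 1) := by
      simpa [hm'.ne'] using hsum.div_const (m : ℝ)
    refine tendsto_of_tendsto_of_tendsto_of_le_of_le' hlow tendsto_const_nhds ?_ ?_
    · filter_upwards [hpos, hsum.eventually_const_lt hm'] with w hw hw'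
      have hle := sum_sq_diag_le_sum_sq (C w)
      rw [diagNumber]
      refine div_le_div_of_nonneg_left hw'.le (hw'.trans_le hle) ?_
      rw [frob w hw]
      exact rhoSq_le Jbar w
    · exact Eventually.of_forall fun w => div_le_one_of_le₀ (sum_sq_diag_le_sum_sq _)
        (Finset.sum_nonneg fun a _ => Finset.sum_nonneg fun b _ => sq_nonneg _)
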